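/- Let $I$ be a nonempty directed set that has a countable cofinal subset (for example $I=\mathbb N$). Let $H_i$ $(i\in I)$ and $H$ be complete separable $\mathrm{CAT}(0)$-spaces, and let an asymptotic relation between $\{H_i\}$ and $H$ be given, i.e. a topology on the disjoint union $\mathcal H=(\bigsqcup_i H_i)\sqcup H$ such that: (A1) all $H_i$ and $H$ are closed in $\mathcal H$ and inherit from $\mathcal H$ their original topologies; (A2) for every $x\in H$ there is a net $x_i\in H_i$ with $x_i\to x$ in $\mathcal H$; (A3) if $H_i\ni x_i\to x\in H$ and $H_i\ni y_i\to y\in H$ in $\mathcal H$, then $d_{H_i}(x_i,y_i)\to d_H(x,y)$; (A4) if $H_i\ni x_i\to x\in H$ in $\mathcal H$ and $y_i\in H_i$ satisfy $d_{H_i}(x_i,y_i)\to 0$, then $y_i\to x$ in $\mathcal H$. Convergence in $\mathcal H$ of a net $x_i\in H_i$ to a point $x\in H$ is called strong convergence. A net $x_i\in H_i$ converges weakly to $x\in H$ if, for all geodesics $\gamma_i:[0,1]\to H_i$ and $\gamma:[0,1]\to H$ with $\gamma(0)=x$ and $\gamma_i(t)\to\gamma(t)$ strongly for every $t\in[0,1]$,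 the nearest-point projections of $x_i$ to $\gamma_i([0,1])$ converge strongly to $x$. Let $E_i:H_i\to[0,+\infty]$ and $E:H\to[0,+\infty]$ be lower semicontinuous, convex along geodesics, and not identically $+\infty$. Assume that $E_i$ converges to $E$ in the Mosco sense: ($\Gamma1$) for every $x\in H$ there are $x_i\in H_i$ with $x_i\to x$ strongly and $E_i(x_i)\to E(x)$; ($\Gamma2'$) if $H_i\ni x_i\to x\in H$ weakly, then $E(x)\le\liminf_i E_i(x_i)$. For $\lambda>0$ let $E^\lambda(x)=\inf_{y\in H}\bigl(\lambda E(y)+d_H(x,y)^2\bigr)$ be the Moreau–Yosida approximation of $E$, and let the resolvent $J_\lambda(x)$ be the unique point $y\in H$ at which this infimum is attained; define $E_i^\lambda$ and $J^i_\lambda$ on $H_i$ in the same way from $E_i$. Then for every $\lambda>0$ and every strongly convergent net $H_i\ni x_i\to x\in H$: (1) $E_i^\lambda(x_i)\to E^\lambda(x)$, i.e. $E_i^\lambda$ converges strongly to $E^\lambda$; (2) $J^i_\lambda(x_i)\to J_\lambda(x)$ strongly, i.e. $J^i_\lambda$ converges strongly to $J_\lambda$. -/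

import Mathlib

open Filter Topology Set
open scoped ENNReal

universe u v w

namespace VarConv

/-! ### Geodesics and CAT(0)-spaces -/

/-- A (minimal) geodesic parametrized on `[0,1]` proportionally to arclength. -/
def IsGeodesic {X : Type*} [MetricSpace X] (γ : unitInterval → X) : Prop :=
  ∀ s t : unitInterval, dist (γ s) (γ t) = |(s : ℝ) - (t : ℝ)| * dist (γ 0) (γ 1)

/-- A `CAT(0)`-space: a geodesic metric space with the triangle comparison condition. -/
structure IsCAT0 (X : Type*) [MetricSpace X] : Prop where
  /-- any two points are joined by a geodesic -/
  geodesic : ∀ x y : X, ∃ γ : unitInterval → X, IsGeodesic γ ∧ γ 0 = x ∧ γ 1 = y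
  /-- for edges `γ = xy`, `σ = xz` of a triangle `xyz` and a comparison triangle `x'y'z'` in the
  Euclidean plane, points `a` of `xy`, `b` of `xz` are at most as far apart as the corresponding
  points `a'` of `x'y'`, `b'` of `x'z'` -/
  comparison : ∀ (γ σ : unitInterval → X), IsGeodesic γ → IsGeodesic σ → γ 0 = σ 0 →
    ∀ x' y' z' : EuclideanSpace ℝ (Fin 2),
      dist x' y' = dist (γ 0) (γ 1) → dist x' z' = dist (γ 0) (σ 1) →
      dist y' z' = dist (γ 1) (σ 1) →
      ∀ a ∈ range γ, ∀ b ∈ range σ, ∀ a' ∈ segment ℝ x' y', ∀ b' ∈ segment ℝ x' z',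
        dist (γ 0) a = dist x' a' → dist (γ 0) b = dist x' b' → dist a b ≤ dist a' b'

/-- The nearest point projection `π_C(x)`: a point of `C` at minimal distance from `x`
(with the default value `x` if there is none). -/
noncomputable def nearestPoint {X : Type*} [MetricSpace X] (C : Set X) (x : X) : X :=
  open Classical in
  if h : ∃ p ∈ C, ∀ q ∈ C, dist x p ≤ dist x q then h.choose else x

/-- Convexity of a functional along geodesics. -/
def GeodesicallyConvex {X : Type*} [MetricSpace X] (E : X → ℝ≥0∞) : Prop :=
  ∀ γ : unitInterval → X, IsGeodesic γ → ∀ t : unitInterval,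
    E (γ t) ≤ ENNReal.ofReal (1 - (t : ℝ)) * E (γ 0) + ENNReal.ofReal (t : ℝ) * E (γ 1)

/-! ### Asymptotic relations -/

/-- The disjoint union `(⨆ᵢ Xᵢ) ⊔ X` (as a set, without a topology). -/
inductive TotalSpace {ι : Type u} (X : ι → Type v) (Y : Type w) : Type (max u v w)
  | fiber (i : ι) (x : X i) : TotalSpace X Y
  | limit (y : Y) : TotalSpace X Y

section

variable {ι : Type u} [Preorder ι] {X : ι → Type v} {Y : Type w}

/-- Strong convergence `Xᵢ ∋ xᵢ → y ∈ Y` of nets: convergence in the topology `τ` on the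
disjoint union. -/
def StrongConv (τ : TopologicalSpace (TotalSpace X Y)) (x : ∀ i, X i) (y : Y) : Prop :=
  Tendsto (fun i => (TotalSpace.fiber i (x i) : TotalSpace X Y)) atTop
    (@nhds _ τ (TotalSpace.limit y))

variable [∀ i, MetricSpace (X i)] [MetricSpace Y]

/-- The topology `τ` on the disjoint union is an asymptotic relation between `{Xᵢ}` and `Y`. -/
structure IsAsymptoticRelation (τ : TopologicalSpace (TotalSpace X Y)) : Prop where
  /-- each `Xᵢ` is closed and carries its original topology as the subspace topology -/
  isClosedEmbedding_fiber :
    ∀ i, @IsClosedEmbedding _ _ _ τ (fun x : X i => (TotalSpace.fiber i x : TotalSpace X Y))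
  /-- `Y` is closed and carries its original topology as the subspace topology -/
  isClosedEmbedding_limit :
    @IsClosedEmbedding _ _ _ τ (fun y : Y => (TotalSpace.limit y : TotalSpace X Y))
  exists_strongConv : ∀ y : Y, ∃ x : ∀ i, X i, StrongConv τ x y
  tendsto_dist : ∀ (x x' : ∀ i, X i) (y y' : Y), StrongConv τ x y → StrongConv τ x' y' →
    Tendsto (fun i => dist (x i) (x' i)) atTop (𝓝 (dist y y'))
  strongConv_of_dist : ∀ (x x' : ∀ i, X i) (y : Y), StrongConv τ x y →
    Tendsto (fun i => dist (x i) (x' i)) atTop (𝓝 0) → StrongConv τ x' y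

/-- Weak convergence `Xᵢ ∋ xᵢ → y ∈ Y`: whenever geodesic segments `γᵢ` strongly converge to a
geodesic segment `γ` emanating from `y`, the projections of `xᵢ` to `γᵢ` strongly converge
to `y`. -/
def WeakConv (τ : TopologicalSpace (TotalSpace X Y)) (x : ∀ i, X i) (y : Y) : Prop :=
  ∀ (γ : ∀ i, unitInterval → X i) (σ : unitInterval → Y),
    (∀ i, IsGeodesic (γ i)) → IsGeodesic σ → σ 0 = y →
    (∀ t, StrongConv τ (fun i => γ i t) (σ t)) →
    StrongConv τ (fun i => nearestPoint (range (γ i)) (x i)) y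

/-- Mosco convergence of functionals `Eᵢ` on `Xᵢ` to a functional `F` on `Y`. -/
structure MoscoConv (τ : TopologicalSpace (TotalSpace X Y)) (E : ∀ i, X i → ℝ≥0∞)
    (F : Y → ℝ≥0∞) : Prop where
  exists_recovery : ∀ y : Y, ∃ x : ∀ i, X i, StrongConv τ x y ∧
    Tendsto (fun i => E i (x i)) atTop (𝓝 (F y))
  le_liminf : ∀ (x : ∀ i, X i) (y : Y), WeakConv τ x y →
    F y ≤ liminf (fun i => E i (x i)) atTop

end

section

variable {ι : Type u} [Preorder ι] {X : ι → Type v} {Y : Type w}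

/-- Strong convergence of functions `fᵢ : Xᵢ → [0,∞]` to `f : Y → [0,∞]`. -/
def StrongConvFun (τ : TopologicalSpace (TotalSpace X Y)) (f : ∀ i, X i → ℝ≥0∞)
    (g : Y → ℝ≥0∞) : Prop :=
  ∀ (x : ∀ i, X i) (y : Y), StrongConv τ x y → Tendsto (fun i => f i (x i)) atTop (𝓝 (g y))

/-- Strong convergence of maps `fᵢ : Xᵢ → Xᵢ` to `g : Y → Y`. -/
def StrongConvMap (τ : TopologicalSpace (TotalSpace X Y)) (f : ∀ i, X i → X i)
    (g : Y → Y) : Prop :=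
  ∀ (x : ∀ i, X i) (y : Y), StrongConv τ x y → StrongConv τ (fun i => f i (x i)) (g y)

end

/-! ### Moreau–Yosida approximation and resolvent -/

/-- The Moreau–Yosida approximation `E^λ(x) = inf_y (λ E(y) + d(x,y)²)`. -/
noncomputable def moreauYosida {X : Type*} [MetricSpace X] (E : X → ℝ≥0∞) (lam : ℝ) (x : X) :
    ℝ≥0∞ :=
  ⨅ y : X, ENNReal.ofReal lam * E y + edist x y ^ 2

/-- The resolvent `J_λ(x)`: the point `y` with `E^λ(x) = λ E(y) + d(x,y)²`. Such a point exists
and is unique for `λ > 0` if the space is complete `CAT(0)` and `E` is lower semicontinuous,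
convex and not identically `∞` (default value `x` if there is no such point). -/
noncomputable def functionalResolvent {X : Type*} [MetricSpace X] (E : X → ℝ≥0∞) (lam : ℝ) (x : X) : X :=
  open Classical in
  if h : ∃ y : X, moreauYosida E lam x = ENNReal.ofReal lam * E y + edist x y ^ 2
  then h.choose else x

end VarConv

open VarConv

/-! Countable cofinality makes `atTop` countably generated, so it suffices to refine every sequence
of indices `v` to a subsequence with the desired limits (`MoscoConv.exists_subseq_tendsto`). Let z_i
= J^i_λ(x_i). A recovery net at J_λ(x) bounds E_i^λ(x_i) from above, hence bounds d(x_i, z_i).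
Separability of H gives a subsequence along which d(z_i, r_i) → g(p) for every strongly convergent
r_i → p. The CAT(0) inequality passes to g², so g has a minimizer c with g(c)² + d(c, p)² ≤ g(p)²
(`IsAsymptoticDist.exists_center`). Along the subsequence z_i converges weakly to c
(`IsAsymptoticDist.weakConv`), and the Mosco inequality yields λE(c) + g(x)² ≤ liminf E_i^λ(x_i) ≤
limsup E_i^λ(x_i) ≤ E^λ(x) ≤ λE(c) + d(x, c)² ≤ λE(c) + g(x)² − g(c)². Equality holds throughout:
E_i^λ(x_i) → E^λ(x), c = J_λ(x), and g(c) = 0, which upgrades weak convergence to strong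
convergence. -/

/-- Three nonnegative reals satisfying the triangle inequalities are the side lengths of a
triangle in the Euclidean plane. -/
theorem exists_comparison_triangle {a b c : ℝ} (ha : 0 ≤ a) (hb : 0 ≤ b) (hc : 0 ≤ c)
    (habc : a ≤ b + c) (hbac : b ≤ a + c) (hcab : c ≤ a + b) :
    ∃ x y z : EuclideanSpace ℝ (Fin 2), dist x y = a ∧ dist x z = b ∧ dist y z = c := by
  rcases ha.eq_or_lt with rfl | ha'
  · have hbc : b = c := by linarith
    subst hbc
    refine ⟨!₂[0, 0], !₂[0, 0], !₂[b, 0], by simp, ?_, ?_⟩ <;>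
      simp [EuclideanSpace.dist_eq, Real.sqrt_sq hb, Real.dist_eq]
  -- Law of cosines: `p` is the abscissa of the third vertex when the side `a` lies on the first
  -- axis.
  · set p : ℝ := (a ^ 2 + b ^ 2 - c ^ 2) / (2 * a) with hp
    have hpa : 2 * a * p = a ^ 2 + b ^ 2 - c ^ 2 := by rw [hp]; field_simp
    have h1 : p ≤ b := by
      have : (2 * a) * p ≤ (2 * a) * b := by nlinarith
      exact le_of_mul_le_mul_left this (by linarith)
    have h2 : -b ≤ p := by
      have : (2 * a) * (-b) ≤ (2 * a) * p := by nlinarith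
      exact le_of_mul_le_mul_left this (by linarith)
    have h3 : 0 ≤ b ^ 2 - p ^ 2 := by nlinarith
    refine ⟨!₂[0, 0], !₂[a, 0], !₂[p, √(b ^ 2 - p ^ 2)], ?_, ?_, ?_⟩
    · simp [EuclideanSpace.dist_eq, Real.dist_eq, Real.sqrt_sq ha]
    · simp only [EuclideanSpace.dist_eq, Real.dist_eq, Fin.sum_univ_two, sq_abs]
      simp only [Matrix.cons_val_zero, Matrix.cons_val_one, zero_sub, neg_sq,
        Real.sq_sqrt h3]
      rw [show p ^ 2 + (b ^ 2 - p ^ 2) = b ^ 2 by ring, Real.sqrt_sq hb]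
    · simp only [EuclideanSpace.dist_eq, Real.dist_eq, Fin.sum_univ_two, sq_abs]
      simp only [Matrix.cons_val_zero, Matrix.cons_val_one, zero_sub, neg_sq,
        Real.sq_sqrt h3]
      rw [show (a - p) ^ 2 + (b ^ 2 - p ^ 2) = c ^ 2 by nlinarith, Real.sqrt_sq hc]

theorem dist_convex_combination_sq {V : Type*} [NormedAddCommGroup V] [InnerProductSpace ℝ V]
    (x y z : V) (t : ℝ) :
    dist ((1 - t) • x + t • y) z ^ 2 =
      (1 - t) * dist x z ^ 2 + t * dist y z ^ 2 - t * (1 - t) * dist x y ^ 2 := by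
  have h1 : (1 - t) • x + t • y - z = (1 - t) • (x - z) + t • (y - z) := by module
  have h2 : x - y = (x - z) - (y - z) := by module
  rw [dist_eq_norm, dist_eq_norm, dist_eq_norm, dist_eq_norm, h1, h2, norm_add_sq_real,
    norm_sub_sq_real (x - z), norm_smul, norm_smul, inner_smul_left, inner_smul_right, mul_pow,
    mul_pow, Real.norm_eq_abs, Real.norm_eq_abs, sq_abs, sq_abs]
  simp only [conj_trivial]
  ring

/-! ### Quadratic inequality and projections in CAT(0)-spaces -/

section Geodesic

variable {X : Type*} [MetricSpace X]

theorem VarConv.IsGeodesic.dist_zero {γ : unitInterval → X} (hγ : IsGeodesic γ) (t : unitInterval) :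
    dist (γ t) (γ 0) = t * dist (γ 0) (γ 1) := by
  rw [hγ t 0]; simp [abs_of_nonneg t.2.1]

theorem VarConv.IsGeodesic.dist_one {γ : unitInterval → X} (hγ : IsGeodesic γ) (t : unitInterval) :
    dist (γ t) (γ 1) = (1 - t) * dist (γ 0) (γ 1) := by
  rw [hγ t 1]
  have : |(t : ℝ) - ((1 : unitInterval) : ℝ)| = 1 - t := by
    rw [abs_sub_comm, abs_of_nonneg] <;> simp [t.2.2]
  rw [this]

theorem VarConv.IsGeodesic.continuous {γ : unitInterval → X} (hγ : IsGeodesic γ) :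
    Continuous γ := by
  refine (LipschitzWith.of_dist_le_mul (K := ⟨dist (γ 0) (γ 1), dist_nonneg⟩) fun s t => ?_).continuous
  rw [hγ s t, mul_comm]
  rfl

/-- The quadratic inequality along geodesics characterizing nonpositive curvature. -/
theorem VarConv.IsCAT0.dist_sq_geodesic_le (hX : IsCAT0 X) {γ : unitInterval → X}
    (hγ : IsGeodesic γ) (t : unitInterval) (z : X) :
    dist (γ t) z ^ 2 ≤ (1 - t) * dist (γ 0) z ^ 2 + t * dist (γ 1) z ^ 2
      - t * (1 - t) * dist (γ 0) (γ 1) ^ 2 := by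
  obtain ⟨σ, hσ, hσ0, hσ1⟩ := hX.geodesic (γ 0) z
  obtain ⟨x', y', z', hxy, hxz, hyz⟩ := exists_comparison_triangle
    (dist_nonneg (x := γ 0) (y := γ 1)) (dist_nonneg (x := γ 0) (y := z))
    (dist_nonneg (x := γ 1) (y := z))
    (by simpa [dist_comm z] using dist_triangle (γ 0) z (γ 1))
    (dist_triangle _ _ _)
    (by simpa [dist_comm (γ 1) (γ 0)] using dist_triangle (γ 1) (γ 0) z)
  have hseg : (1 - (t : ℝ)) • x' + (t : ℝ) • y' ∈ segment ℝ x' y' :=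
    ⟨1 - t, t, by linarith [t.2.2], t.2.1, by ring, rfl⟩
  have hdist : dist x' ((1 - (t : ℝ)) • x' + (t : ℝ) • y') = t * dist x' y' := by
    rw [dist_eq_norm, dist_eq_norm,
      show x' - ((1 - (t : ℝ)) • x' + (t : ℝ) • y') = (t : ℝ) • (x' - y') by module,
      norm_smul, Real.norm_eq_abs, abs_of_nonneg t.2.1]
  have key := hX.comparison γ σ hγ hσ hσ0.symm x' y' z' hxy (by rw [hσ1, hxz])
    (by rw [hσ1, hyz]) (γ t) (mem_range_self t) z ⟨1, hσ1⟩ _ hseg z' (right_mem_segment ℝ x' z')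
    (by rw [hdist, hxy, dist_comm, hγ.dist_zero]) hxz.symm
  calc dist (γ t) z ^ 2 ≤ dist ((1 - (t : ℝ)) • x' + (t : ℝ) • y') z' ^ 2 := by gcongr
    _ = _ := by rw [dist_convex_combination_sq, hxy, hxz, hyz]

/-- The quadratic inequality for a point `m` dividing `p q` in the ratio `t : 1 - t`. -/
theorem VarConv.IsCAT0.dist_sq_le_of_between (hX : IsCAT0 X) {p q m : X} {t : unitInterval}
    (hp : dist m p = t * dist p q) (hq : dist m q = (1 - t) * dist p q) (z : X) :
    dist m z ^ 2 ≤ (1 - t) * dist p z ^ 2 + t * dist q z ^ 2 - t * (1 - t) * dist p q ^ 2 := by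
  obtain ⟨γ, hγ, rfl, rfl⟩ := hX.geodesic p q
  -- With `z = m` the right-hand side cancels to zero, so `m` must be `γ t`.
  have h := hX.dist_sq_geodesic_le hγ t m
  rw [dist_comm _ m, dist_comm _ m, dist_comm _ m, hp, hq] at h
  have h0 : dist m (γ t) ^ 2 ≤ 0 := h.trans (le_of_eq (by ring))
  have : m = γ t := dist_eq_zero.1 (pow_eq_zero_iff two_ne_zero |>.1 (le_antisymm h0 (sq_nonneg _)))
  rw [this]
  exact hX.dist_sq_geodesic_le hγ t z

theorem VarConv.nearestPoint_spec {C : Set X} (hC : IsCompact C) (hne : C.Nonempty) (x : X) :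
    nearestPoint C x ∈ C ∧ ∀ q ∈ C, dist x (nearestPoint C x) ≤ dist x q := by
  have h : ∃ p ∈ C, ∀ q ∈ C, dist x p ≤ dist x q :=
    hC.exists_isMinOn hne (continuous_const.dist continuous_id).continuousOn
  rw [nearestPoint, dif_pos h]
  exact h.choose_spec

/-- Projection to a geodesic segment: Pythagorean inequality (with a non-optimal constant). -/
theorem VarConv.IsCAT0.dist_nearestPoint_sq_le (hX : IsCAT0 X) {γ : unitInterval → X}
    (hγ : IsGeodesic γ) (x : X) :
    dist (γ 0) (nearestPoint (range γ) x) ^ 2 ≤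
      2 * (dist x (γ 0) ^ 2 - dist x (nearestPoint (range γ) x) ^ 2) := by
  obtain ⟨⟨s, hs⟩, hmin⟩ := nearestPoint_spec (isCompact_range hγ.continuous)
    (range_nonempty γ) x
  rw [← hs] at hmin ⊢
  -- The midpoint of `γ 0` and the projection `γ s` lies on `γ`, so it is no closer to `x` than `γ
  -- s`; the weight 1/2 produces the constant 2.
  let h : unitInterval := ⟨1 / 2, by norm_num, by norm_num⟩
  have hh : ((h : unitInterval) : ℝ) = 1 / 2 := rfl
  have hhs : ((h * s : unitInterval) : ℝ) = s / 2 := by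
    change (1 / 2 : ℝ) * s = s / 2; ring
  have h1 := hX.dist_sq_le_of_between (p := γ 0) (q := γ s) (m := γ (h * s)) (t := h)
    (by rw [hγ.dist_zero, dist_comm (γ 0) (γ s), hγ.dist_zero, hhs, hh]; ring)
    (by
      rw [hγ (h * s) s, dist_comm (γ 0) (γ s), hγ.dist_zero, hhs, hh, abs_sub_comm,
        abs_of_nonneg (by linarith [s.2.1])]
      ring) x
  have h2 := hmin (γ (h * s)) (mem_range_self _)
  rw [dist_comm _ x, dist_comm _ x, dist_comm _ x, hh] at h1
  have h3 : dist x (γ s) ^ 2 ≤ dist x (γ (h * s)) ^ 2 := by gcongr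
  linarith

theorem VarConv.IsGeodesic.dist_nearestPoint_le {γ : unitInterval → X}
    (hγ : IsGeodesic γ) (x : X) :
    dist (γ 0) (nearestPoint (range γ) x) ≤ 2 * dist (γ 0) x := by
  have h := (nearestPoint_spec (isCompact_range hγ.continuous) (range_nonempty γ) x).2 (γ 0)
    (mem_range_self 0)
  have := dist_triangle (γ 0) x (nearestPoint (range γ) x)
  rw [dist_comm x (γ 0)] at h
  linarith

end Geodesic

/-! ### Minimization of uniformly convex functionals -/

section Minimizer

variable {X : Type*} [MetricSpace X]

/-- The midpoint value cannot drop below `I`, so the convexity gain is at most `ε`. This gives both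
uniqueness (`ε = 0`) and the Cauchy property of minimizing sequences. -/
theorem dist_sq_le_of_midpoint_convex {F : X → ℝ≥0∞}
    (hF : ∀ p q, ∃ m, F m + edist p q ^ 2 / 4 ≤ (F p + F q) / 2) {I : ℝ≥0∞} (hI : I ≠ ∞)
    (hmin : ∀ x, I ≤ F x) {p q : X} {ε : ℝ≥0∞} (hp : F p ≤ I + ε) (hq : F q ≤ I + ε) :
    edist p q ^ 2 / 4 ≤ ε := by
  obtain ⟨m, hm⟩ := hF p q
  have h : I + edist p q ^ 2 / 4 ≤ I + ε := calc
    I + edist p q ^ 2 / 4 ≤ F m + edist p q ^ 2 / 4 := by gcongr; exact hmin m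
    _ ≤ (F p + F q) / 2 := hm
    _ ≤ ((I + ε) + (I + ε)) / 2 := by gcongr
    _ = I + ε := by
      rw [← two_mul, mul_comm, ENNReal.mul_div_cancel_right two_ne_zero ENNReal.ofNat_ne_top]
  exact (ENNReal.add_le_add_iff_left hI).1 h

/-- A uniformly midpoint convex functional has at most one minimizer. -/
theorem eq_of_minimizers_of_midpoint_convex {F : X → ℝ≥0∞}
    (hF : ∀ p q, ∃ m, F m + edist p q ^ 2 / 4 ≤ (F p + F q) / 2) {p q : X} (hfin : F p ≠ ∞)
    (hp : ∀ x, F p ≤ F x) (hq : ∀ x, F q ≤ F x) : p = q := by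
  have h := dist_sq_le_of_midpoint_convex hF hfin hp (p := p) (q := q) (ε := 0) (by simp)
    (by simpa using hq p)
  simpa using h

/-- A uniformly midpoint convex, lower semicontinuous, proper functional on a complete space
attains its infimum. -/
theorem exists_minimizer_of_midpoint_convex [CompleteSpace X] {F : X → ℝ≥0∞}
    (hF : ∀ p q, ∃ m, F m + edist p q ^ 2 / 4 ≤ (F p + F q) / 2) (hlsc : LowerSemicontinuous F)
    (hprop : ∃ x, F x ≠ ∞) : ∃ y, ∀ x, F y ≤ F x := by
  obtain ⟨x₀, hx₀⟩ := hprop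
  set I := ⨅ x, F x with hIdef
  have hI : I ≠ ∞ := ((iInf_le F x₀).trans_lt hx₀.lt_top).ne
  have hex : ∀ n : ℕ, ∃ p, F p ≤ I + ENNReal.ofReal (1 / ((n : ℝ) + 1)) := fun n => by
    have : I < I + ENNReal.ofReal (1 / ((n : ℝ) + 1)) :=
      ENNReal.lt_add_right hI (by rw [Ne, ENNReal.ofReal_eq_zero, not_le]; positivity)
    obtain ⟨p, hp⟩ := iInf_lt_iff.1 this
    exact ⟨p, hp.le⟩
  choose p hp using hex
  have hlim : Tendsto (fun n : ℕ => (1 : ℝ) / ((n : ℝ) + 1)) atTop (𝓝 0) :=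
    tendsto_one_div_add_atTop_nhds_zero_nat
  have hp' : ∀ n N : ℕ, N ≤ n → F (p n) ≤ I + ENNReal.ofReal (1 / ((N : ℝ) + 1)) :=
    fun n N h => (hp n).trans (by gcongr)
  have hcauchy : CauchySeq p := by
    refine cauchySeq_of_le_tendsto_0 (fun N : ℕ => √(4 * (1 / ((N : ℝ) + 1)))) ?_ ?_
    · intro n m N hn hm
      have h := dist_sq_le_of_midpoint_convex hF hI (iInf_le F) (hp' n N hn) (hp' m N hm)
      apply Real.le_sqrt_of_sq_le
      rw [edist_dist, ← ENNReal.ofReal_pow dist_nonneg,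
        show (4 : ℝ≥0∞) = ENNReal.ofReal 4 by simp, ← ENNReal.ofReal_div_of_pos (by norm_num),
        ENNReal.ofReal_le_ofReal_iff (by positivity)] at h
      linarith
    · simpa using (hlim.const_mul 4).sqrt
  obtain ⟨y, hy⟩ := cauchySeq_tendsto_of_complete hcauchy
  refine ⟨y, fun x => ?_⟩
  suffices h : F y ≤ I from h.trans (iInf_le F x)
  refine le_of_forall_lt fun c hc => ?_
  have h1 : ∀ᶠ n in atTop, c < F (p n) := hy.eventually (hlsc y c hc)
  obtain ⟨c', hc', hc''⟩ := exists_between hc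
  have h2 : ∀ᶠ n in atTop, c' < F (p n) := hy.eventually (hlsc y c' hc'')
  have h3 : Tendsto (fun n : ℕ => I + ENNReal.ofReal (1 / ((n : ℝ) + 1))) atTop (𝓝 I) := by
    simpa using (ENNReal.tendsto_ofReal hlim).const_add I
  exact hc'.trans_le (ge_of_tendsto h3 (h2.mono fun n hn => hn.le.trans (hp n)))

end Minimizer

/-! ### Existence and uniqueness of the resolvent -/

section Resolvent

variable {X : Type*} [MetricSpace X] {E : X → ℝ≥0∞} {lam : ℝ}

/-- The squared distance supplies all of the uniform convexity; `E` only has to be convex. -/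
theorem VarConv.IsCAT0.moreauYosida_midpoint_convex (hX : IsCAT0 X) (hE : GeodesicallyConvex E)
    (x p q : X) : ∃ m, (ENNReal.ofReal lam * E m + edist x m ^ 2) + edist p q ^ 2 / 4 ≤
      ((ENNReal.ofReal lam * E p + edist x p ^ 2) +
        (ENNReal.ofReal lam * E q + edist x q ^ 2)) / 2 := by
  obtain ⟨γ, hγ, rfl, rfl⟩ := hX.geodesic p q
  let h : unitInterval := ⟨1 / 2, by norm_num, by norm_num⟩
  have hh : ((h : unitInterval) : ℝ) = 1 / 2 := rfl
  have h1 := hX.dist_sq_geodesic_le hγ h x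
  have h2 := hE γ hγ h
  rw [hh] at h1 h2
  have half : ENNReal.ofReal (1 / 2) = 2⁻¹ := by
    rw [one_div, ENNReal.ofReal_inv_of_pos (by norm_num)]; simp
  rw [show (1 : ℝ) - 1 / 2 = 1 / 2 by norm_num, half] at h2
  have h3 : edist x (γ h) ^ 2 + edist (γ 0) (γ 1) ^ 2 / 4 ≤
      (edist x (γ 0) ^ 2 + edist x (γ 1) ^ 2) / 2 := by
    simp only [edist_dist]
    rw [← ENNReal.ofReal_pow dist_nonneg, ← ENNReal.ofReal_pow dist_nonneg,
      ← ENNReal.ofReal_pow dist_nonneg, ← ENNReal.ofReal_pow dist_nonneg,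
      show (4 : ℝ≥0∞) = ENNReal.ofReal 4 by simp, show (2 : ℝ≥0∞) = ENNReal.ofReal 2 by simp,
      ← ENNReal.ofReal_div_of_pos (by norm_num), ← ENNReal.ofReal_add (by positivity)
      (by positivity), ← ENNReal.ofReal_add (by positivity) (by positivity),
      ← ENNReal.ofReal_div_of_pos (by norm_num)]
    apply ENNReal.ofReal_le_ofReal
    rw [dist_comm x, dist_comm x, dist_comm x]
    linarith
  refine ⟨γ h, ?_⟩
  calc _ = ENNReal.ofReal lam * E (γ h) + (edist x (γ h) ^ 2 + edist (γ 0) (γ 1) ^ 2 / 4) := by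
        ring
    _ ≤ ENNReal.ofReal lam * (2⁻¹ * E (γ 0) + 2⁻¹ * E (γ 1)) +
        (edist x (γ 0) ^ 2 + edist x (γ 1) ^ 2) / 2 := by gcongr
    _ = _ := by simp only [div_eq_mul_inv]; ring

theorem lowerSemicontinuous_moreauYosida (hE : LowerSemicontinuous E) (x : X) :
    LowerSemicontinuous fun y => ENNReal.ofReal lam * E y + edist x y ^ 2 := by
  refine LowerSemicontinuous.add ?_ ?_
  · exact (ENNReal.continuous_const_mul ENNReal.ofReal_ne_top).comp_lowerSemicontinuous hE
      fun a b h => mul_le_mul' le_rfl h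
  · exact ((ENNReal.continuous_pow 2).comp (continuous_const.edist continuous_id)).lowerSemicontinuous

theorem moreauYosida_le (x y : X) :
    moreauYosida E lam x ≤ ENNReal.ofReal lam * E y + edist x y ^ 2 :=
  iInf_le _ y

theorem moreauYosida_ne_top (hprop : ∃ x, E x ≠ ∞) (x : X) : moreauYosida E lam x ≠ ∞ := by
  obtain ⟨y, hy⟩ := hprop
  refine ((moreauYosida_le x y).trans_lt ?_).ne
  exact ENNReal.add_lt_top.2 ⟨ENNReal.mul_lt_top ENNReal.ofReal_lt_top hy.lt_top,
    ENNReal.pow_lt_top (edist_lt_top _ _)⟩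

theorem VarConv.IsCAT0.functionalResolvent_spec [CompleteSpace X] (hX : IsCAT0 X)
    (hconv : GeodesicallyConvex E) (hlsc : LowerSemicontinuous E) (hprop : ∃ x, E x ≠ ∞) (x : X) :
    moreauYosida E lam x = ENNReal.ofReal lam * E (functionalResolvent E lam x) +
      edist x (functionalResolvent E lam x) ^ 2 := by
  have h : ∃ y, moreauYosida E lam x = ENNReal.ofReal lam * E y + edist x y ^ 2 := by
    obtain ⟨y, hy⟩ := exists_minimizer_of_midpoint_convex
      (hX.moreauYosida_midpoint_convex (lam := lam) hconv x)
      (lowerSemicontinuous_moreauYosida hlsc x) (by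
        obtain ⟨y, hy⟩ := hprop
        exact ⟨y, (ENNReal.add_lt_top.2 ⟨ENNReal.mul_lt_top ENNReal.ofReal_lt_top hy.lt_top,
          ENNReal.pow_lt_top (edist_lt_top _ _)⟩).ne⟩)
    exact ⟨y, le_antisymm (moreauYosida_le x y) (le_iInf hy)⟩
  rw [functionalResolvent, dif_pos h]
  exact h.choose_spec

theorem VarConv.IsCAT0.eq_functionalResolvent [CompleteSpace X] (hX : IsCAT0 X)
    (hconv : GeodesicallyConvex E) (hlsc : LowerSemicontinuous E) (hprop : ∃ x, E x ≠ ∞) {x y : X}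
    (hy : ENNReal.ofReal lam * E y + edist x y ^ 2 ≤ moreauYosida E lam x) :
    y = functionalResolvent E lam x :=
  eq_of_minimizers_of_midpoint_convex (hX.moreauYosida_midpoint_convex (lam := lam) hconv x)
    (hy.trans_lt (moreauYosida_ne_top hprop x).lt_top).ne
    (fun z => hy.trans (moreauYosida_le x z))
    (fun z => (hX.functionalResolvent_spec hconv hlsc hprop x).ge.trans (moreauYosida_le x z))

end Resolvent

/-- The tails starting at members of `S` form a countable basis, so limits along `ι` can be tested
on sequences. -/
theorem isCountablyGenerated_atTop_of_isCofinal {ι : Type*} [Preorder ι] [IsDirectedOrder ι]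
    [Nonempty ι] (h : ∃ S : Set ι, S.Countable ∧ IsCofinal S) :
    (atTop : Filter ι).IsCountablyGenerated := by
  obtain ⟨S, hS, hcof⟩ := h
  refine (HasCountableBasis.mk (p := fun i => i ∈ S) (s := fun i => Ici i) ⟨fun t => ?_⟩
    hS).isCountablyGenerated
  rw [mem_atTop_sets]
  constructor
  · rintro ⟨a, ha⟩
    obtain ⟨b, hb, hab⟩ := hcof a
    exact ⟨b, hb, fun c hc => ha c (hab.trans hc)⟩
  · rintro ⟨b, -, hb⟩
    exact ⟨b, fun c hc => hb hc⟩

/-! ### Asymptotic distance functions and their centers -/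

section AsymptoticRelation

variable {ι : Type u} [Preorder ι] {X : ι → Type v} {Y : Type w}
  [∀ i, MetricSpace (X i)] [MetricSpace Y] {τ : TopologicalSpace (TotalSpace X Y)}

theorem VarConv.IsAsymptoticRelation.strongConv_iff (hτ : IsAsymptoticRelation τ)
    {r x : ∀ i, X i} {y : Y} (hr : StrongConv τ r y) :
    StrongConv τ x y ↔ Tendsto (fun i => dist (r i) (x i)) atTop (𝓝 0) :=
  ⟨fun hx => by simpa using hτ.tendsto_dist r x y y hr hx, hτ.strongConv_of_dist r x y hr⟩

/-- The complement of the closed fiber over `j` is a neighbourhood of the limit point, so a strongly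
convergent net eventually leaves that fiber. -/
theorem VarConv.IsAsymptoticRelation.eventually_ne (hτ : IsAsymptoticRelation τ) (y : Y) (j : ι) :
    ∀ᶠ i in atTop, i ≠ j := by
  obtain ⟨r, hr⟩ := hτ.exists_strongConv y
  have hopen := (hτ.isClosedEmbedding_fiber j).isClosed_range.isOpen_compl
  have hmem : (TotalSpace.limit y : TotalSpace X Y) ∈
      (range fun x : X j => (TotalSpace.fiber j x : TotalSpace X Y))ᶜ := by
    rintro ⟨x, hx⟩
    cases hx
  filter_upwards [hr (hopen.mem_nhds hmem)] with i hi hij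
  subst hij
  exact hi ⟨r i, rfl⟩

/-- Geodesics whose endpoints converge strongly converge strongly. -/
theorem VarConv.IsAsymptoticRelation.strongConv_geodesic (hτ : IsAsymptoticRelation τ)
    (hX : ∀ i, IsCAT0 (X i)) {γ : ∀ i, unitInterval → X i} {σ : unitInterval → Y}
    (hγ : ∀ i, IsGeodesic (γ i)) (hσ : IsGeodesic σ)
    (h0 : StrongConv τ (fun i => γ i 0) (σ 0)) (h1 : StrongConv τ (fun i => γ i 1) (σ 1))
    (t : unitInterval) : StrongConv τ (fun i => γ i t) (σ t) := by
  obtain ⟨r, hr⟩ := hτ.exists_strongConv (σ t)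
  rw [hτ.strongConv_iff hr]
  -- In the limit the CAT(0) bound is evaluated at `σ t` itself, where its terms cancel.
  have hlim : Tendsto (fun i => (1 - (t : ℝ)) * dist (γ i 0) (r i) ^ 2 +
      t * dist (γ i 1) (r i) ^ 2 - t * (1 - t) * dist (γ i 0) (γ i 1) ^ 2) atTop (𝓝 0) := by
    have := ((((hτ.tendsto_dist _ _ _ _ h0 hr).pow 2).const_mul (1 - (t : ℝ))).add
      (((hτ.tendsto_dist _ _ _ _ h1 hr).pow 2).const_mul (t : ℝ))).sub
      (((hτ.tendsto_dist _ _ _ _ h0 h1).pow 2).const_mul ((t : ℝ) * (1 - t)))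
    convert this using 2
    rw [dist_comm (σ 0) (σ t), dist_comm (σ 1) (σ t), hσ.dist_zero t,
      hσ.dist_one t]
    ring
  have hsq : Tendsto (fun i => dist (r i) (γ i t) ^ 2) atTop (𝓝 0) :=
    squeeze_zero (fun i => sq_nonneg _)
      (fun i => by rw [dist_comm]; exact (hX i).dist_sq_geodesic_le (hγ i) t (r i)) hlim
  simpa [Real.sqrt_sq dist_nonneg] using hsq.sqrt

/-- Given a bounded net `z` and a sequence `v` of indices, along a subsequence the distances of
`z` to all strongly convergent nets converge. -/
theorem VarConv.IsAsymptoticRelation.exists_subseq_tendsto_dist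
    [TopologicalSpace.SeparableSpace Y] (hτ : IsAsymptoticRelation τ) {x z : ∀ i, X i} {y : Y}
    (hx : StrongConv τ x y) {v : ℕ → ι} (hv : Tendsto v atTop atTop) {C : ℝ}
    (hC : ∀ᶠ n in atTop, dist (z (v n)) (x (v n)) ≤ C) :
    ∃ φ : ℕ → ℕ, StrictMono φ ∧ ∃ g : Y → ℝ, ∀ (r : ∀ i, X i) (p : Y), StrongConv τ r p →
      Tendsto (fun n => dist (z (v (φ n))) (r (v (φ n)))) atTop (𝓝 (g p)) := by
  have : Nonempty Y := ⟨y⟩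
  choose R hR using hτ.exists_strongConv
  let d := TopologicalSpace.denseSeq Y
  have hbd : ∀ k, ∃ B, ∀ n, dist (x (v n)) (R (d k) (v n)) ≤ B := fun k => by
    obtain ⟨B, hB⟩ := ((hτ.tendsto_dist _ _ _ _ hx (hR (d k))).comp hv).bddAbove_range
    exact ⟨B, fun n => hB (mem_range_self n)⟩
  choose B hB using hbd
  -- Compactness of a countable product of intervals replaces a diagonal argument over the dense
  -- sequence.
  have hcomp : IsCompact (Set.pi univ fun k : ℕ => Icc (0 : ℝ) (C + B k)) :=
    isCompact_univ_pi fun k => isCompact_Icc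
  obtain ⟨L, -, φ, hφ, hL⟩ := hcomp.tendsto_subseq'
    (x := fun n k => dist (z (v n)) (R (d k) (v n)))
    (hC.mono fun n hn k _ => ⟨dist_nonneg,
      (dist_triangle _ (x (v n)) _).trans (add_le_add hn (hB k n))⟩).frequently
  rw [tendsto_pi_nhds] at hL
  have hvφ : Tendsto (fun n => v (φ n)) atTop atTop := hv.comp hφ.tendsto_atTop
  have hconv : ∀ p, ∃ a, Tendsto (fun n => dist (z (v (φ n))) (R p (v (φ n)))) atTop (𝓝 a) := by
    intro p
    refine cauchySeq_tendsto_of_complete (Metric.cauchySeq_iff'.2 fun ε hε => ?_)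
    obtain ⟨k, hk⟩ := (TopologicalSpace.denseRange_denseSeq Y).exists_dist_lt p
      (show 0 < ε / 4 by positivity)
    have e1 : ∀ᶠ n in atTop, dist (R p (v (φ n))) (R (d k) (v (φ n))) < ε / 4 :=
      ((hτ.tendsto_dist _ _ _ _ (hR p) (hR (d k))).comp hvφ).eventually (gt_mem_nhds hk)
    have e2 : ∀ᶠ n in atTop, dist (dist (z (v (φ n))) (R (d k) (v (φ n)))) (L k) < ε / 4 :=
      Metric.tendsto_nhds.1 (hL k) _ (by positivity)
    obtain ⟨N, hN⟩ := eventually_atTop.1 (e1.and e2)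
    have e3 : ∀ n ≥ N, |dist (z (v (φ n))) (R p (v (φ n))) - L k| < ε / 2 := fun n hn => by
      obtain ⟨h1, h2⟩ := hN n hn
      rw [Real.dist_eq, abs_lt] at h2
      have h3 := dist_triangle (z (v (φ n))) (R p (v (φ n))) (R (d k) (v (φ n)))
      have h4 := dist_triangle_right (z (v (φ n))) (R p (v (φ n))) (R (d k) (v (φ n)))
      rw [abs_lt]
      constructor <;> linarith
    refine ⟨N, fun n hn => ?_⟩
    have h1 := abs_lt.1 (e3 n hn)
    have h2 := abs_lt.1 (e3 N le_rfl)
    rw [Real.dist_eq, abs_lt]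
    constructor <;> linarith
  choose g hg using hconv
  refine ⟨φ, hφ, g, fun r p hr => ?_⟩
  have h0 : Tendsto (fun n => dist (R p (v (φ n))) (r (v (φ n)))) atTop (𝓝 0) :=
    ((hτ.strongConv_iff (hR p)).1 hr).comp hvφ
  refine tendsto_of_tendsto_of_dist (hg p) (squeeze_zero (fun _ => dist_nonneg) (fun n => ?_) h0)
  rw [Real.dist_eq, dist_comm (z (v (φ n))), dist_comm (z (v (φ n)))]
  exact abs_dist_sub_le _ _ _

/-- `g` is the asymptotic distance function of `z` along the sequence of indices `v`. -/
def IsAsymptoticDist (τ : TopologicalSpace (TotalSpace X Y)) (z : ∀ i, X i) (v : ℕ → ι)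
    (g : Y → ℝ) : Prop :=
  ∀ (r : ∀ i, X i) (p : Y), StrongConv τ r p →
    Tendsto (fun n => dist (z (v n)) (r (v n))) atTop (𝓝 (g p))

variable {z : ∀ i, X i} {v : ℕ → ι} {g : Y → ℝ}

theorem IsAsymptoticDist.nonneg (hg : IsAsymptoticDist τ z v g) (hτ : IsAsymptoticRelation τ)
    (p : Y) : 0 ≤ g p := by
  obtain ⟨r, hr⟩ := hτ.exists_strongConv p
  exact ge_of_tendsto' (hg r p hr) fun _ => dist_nonneg

theorem IsAsymptoticDist.continuous (hg : IsAsymptoticDist τ z v g)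
    (hτ : IsAsymptoticRelation τ) (hv : Tendsto v atTop atTop) : Continuous g := by
  refine (LipschitzWith.of_le_add fun p q => ?_).continuous
  obtain ⟨r, hr⟩ := hτ.exists_strongConv p
  obtain ⟨s, hs⟩ := hτ.exists_strongConv q
  refine le_of_tendsto_of_tendsto' (hg r p hr)
    ((hg s q hs).add ((hτ.tendsto_dist r s p q hr hs).comp hv)) fun n => ?_
  exact dist_triangle_right _ _ _

/-- Geodesics in the fibers between approximations of the endpoints converge strongly to `σ`, so the
inequality for the distance to `z` passes to the limit. -/
theorem IsAsymptoticDist.sq_geodesic_le (hg : IsAsymptoticDist τ z v g)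
    (hτ : IsAsymptoticRelation τ) (hX : ∀ i, IsCAT0 (X i)) (hv : Tendsto v atTop atTop)
    {σ : unitInterval → Y} (hσ : IsGeodesic σ) (t : unitInterval) :
    g (σ t) ^ 2 ≤ (1 - t) * g (σ 0) ^ 2 + t * g (σ 1) ^ 2
      - t * (1 - t) * dist (σ 0) (σ 1) ^ 2 := by
  obtain ⟨r, hr⟩ := hτ.exists_strongConv (σ 0)
  obtain ⟨s, hs⟩ := hτ.exists_strongConv (σ 1)
  choose γ hγ hγ0 hγ1 using fun i => (hX i).geodesic (r i) (s i)
  have hm := hτ.strongConv_geodesic hX hγ hσ (by simpa only [hγ0] using hr)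
    (by simpa only [hγ1] using hs) t
  refine le_of_tendsto_of_tendsto' ((hg _ _ hm).pow 2)
    (((((hg _ _ hr).pow 2).const_mul (1 - (t : ℝ))).add
      (((hg _ _ hs).pow 2).const_mul (t : ℝ))).sub
      ((((hτ.tendsto_dist _ _ _ _ hr hs).comp hv).pow 2).const_mul ((t : ℝ) * (1 - t))))
    fun n => ?_
  have := (hX (v n)).dist_sq_geodesic_le (hγ (v n)) t (z (v n))
  rw [hγ0, hγ1] at this
  simpa only [dist_comm _ (z (v n)), Function.comp_apply] using this

/-- The asymptotic center: a minimizer of the asymptotic distance, with a quadratic growth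
estimate. -/
theorem IsAsymptoticDist.exists_center [CompleteSpace Y] [Nonempty Y]
    (hg : IsAsymptoticDist τ z v g) (hτ : IsAsymptoticRelation τ) (hX : ∀ i, IsCAT0 (X i))
    (hY : IsCAT0 Y) (hv : Tendsto v atTop atTop) :
    ∃ c, ∀ p, g c ^ 2 + dist c p ^ 2 ≤ g p ^ 2 := by
  have hmid : ∀ p q : Y, ∃ m, ENNReal.ofReal (g m ^ 2) + edist p q ^ 2 / 4 ≤
      (ENNReal.ofReal (g p ^ 2) + ENNReal.ofReal (g q ^ 2)) / 2 := by
    intro p q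
    obtain ⟨σ, hσ, rfl, rfl⟩ := hY.geodesic p q
    have h := hg.sq_geodesic_le hτ hX hv hσ ⟨1 / 2, by norm_num, by norm_num⟩
    refine ⟨σ ⟨1 / 2, by norm_num, by norm_num⟩, ?_⟩
    rw [edist_dist, ← ENNReal.ofReal_pow dist_nonneg,
      show (4 : ℝ≥0∞) = ENNReal.ofReal 4 by simp, show (2 : ℝ≥0∞) = ENNReal.ofReal 2 by simp,
      ← ENNReal.ofReal_div_of_pos (by norm_num), ← ENNReal.ofReal_add (by positivity)
      (by positivity), ← ENNReal.ofReal_add (by positivity) (by positivity),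
      ← ENNReal.ofReal_div_of_pos (by norm_num)]
    apply ENNReal.ofReal_le_ofReal
    dsimp only at h
    linarith
  obtain ⟨c, hc⟩ := exists_minimizer_of_midpoint_convex hmid
    (ENNReal.continuous_ofReal.comp ((hg.continuous hτ hv).pow 2)).lowerSemicontinuous
    ⟨Classical.arbitrary Y, ENNReal.ofReal_ne_top⟩
  refine ⟨c, fun p => ?_⟩
  obtain ⟨σ, hσ, rfl, rfl⟩ := hY.geodesic c p
  -- Minimality of `c` against `σ t`, divided by `t`; then `t = 1/(n+1) → 0`.
  have key : ∀ n : ℕ, g (σ 0) ^ 2 + (1 - 1 / ((n : ℝ) + 1)) * dist (σ 0) (σ 1) ^ 2 ≤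
      g (σ 1) ^ 2 := by
    intro n
    have hn : (0 : ℝ) < 1 / ((n : ℝ) + 1) := by positivity
    have hn1 : (1 : ℝ) / ((n : ℝ) + 1) ≤ 1 := by
      rw [div_le_one (by positivity)]; linarith [n.cast_nonneg (α := ℝ)]
    set t : ℝ := 1 / ((n : ℝ) + 1)
    have h1 := hg.sq_geodesic_le hτ hX hv hσ ⟨t, hn.le, hn1⟩
    have h2 := (ENNReal.ofReal_le_ofReal_iff (sq_nonneg _)).1 (hc (σ ⟨t, hn.le, hn1⟩))
    dsimp only at h1
    have h3 : t * (g (σ 0) ^ 2 + (1 - t) * dist (σ 0) (σ 1) ^ 2) ≤ t * g (σ 1) ^ 2 := by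
      linarith
    exact le_of_mul_le_mul_left h3 hn
  have hlim : Tendsto (fun n : ℕ => g (σ 0) ^ 2 + (1 - 1 / ((n : ℝ) + 1)) * dist (σ 0) (σ 1) ^ 2)
      atTop (𝓝 (g (σ 0) ^ 2 + (1 - 0) * dist (σ 0) (σ 1) ^ 2)) :=
    ((tendsto_one_div_add_atTop_nhds_zero_nat.const_sub 1).mul_const _).const_add _
  simpa using le_of_tendsto' hlim key

/-- Projections to geodesics emanating from the asymptotic center converge to the center. -/
theorem IsAsymptoticDist.tendsto_dist_nearestPoint (hg : IsAsymptoticDist τ z v g)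
    (hτ : IsAsymptoticRelation τ) (hX : ∀ i, IsCAT0 (X i)) (hv : Tendsto v atTop atTop) {c : Y}
    (hc : ∀ p, g c ^ 2 ≤ g p ^ 2) {γ : ∀ i, unitInterval → X i} {σ : unitInterval → Y}
    (hγ : ∀ i, IsGeodesic (γ i)) (hσ0 : σ 0 = c)
    (hγσ : ∀ t, StrongConv τ (fun i => γ i t) (σ t)) :
    Tendsto (fun n => dist (γ (v n) 0) (nearestPoint (range (γ (v n))) (z (v n)))) atTop
      (𝓝 0) := by
  have hs : ∀ i, ∃ s, γ i s = nearestPoint (range (γ i)) (z i) := fun i =>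
    (nearestPoint_spec (isCompact_range (hγ i).continuous) (range_nonempty (γ i)) (z i)).1
  choose s hs using hs
  -- Along a further subsequence the projection parameters converge to some `a`, so the projection
  -- distances tend to `g (σ a)`, which is at least `g c`; the Pythagorean inequality then forces
  -- equality.
  refine tendsto_of_subseq_tendsto fun ns hns => ?_
  obtain ⟨a, φ, hφ, ha⟩ := CompactSpace.tendsto_subseq fun n => s (v (ns n))
  refine ⟨φ, ?_⟩
  have hnsφ : Tendsto (fun n => ns (φ n)) atTop atTop := hns.comp hφ.tendsto_atTop
  set k : ℕ → ι := fun n => v (ns (φ n)) with hk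
  have hkt : Tendsto k atTop atTop := hv.comp hnsφ
  have h1 : Tendsto (fun n => dist (γ (k n) a) (γ (k n) (s (k n)))) atTop (𝓝 0) := by
    have hsa : Tendsto (fun n => |(a : ℝ) - (s (k n) : ℝ)|) atTop (𝓝 0) := by
      have : Tendsto (fun n => ((s (k n) : unitInterval) : ℝ)) atTop (𝓝 (a : ℝ)) :=
        (continuous_subtype_val.tendsto a).comp ha
      simpa using (this.const_sub (a : ℝ)).abs
    have := hsa.mul ((hτ.tendsto_dist _ _ _ _ (hγσ 0) (hγσ 1)).comp hkt)
    rw [zero_mul] at this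
    exact this.congr fun n => (hγ (k n) a (s (k n))).symm
  have h2 : Tendsto (fun n => dist (z (k n)) (γ (k n) (s (k n)))) atTop (𝓝 (g (σ a))) := by
    refine tendsto_of_tendsto_of_dist ((hg _ _ (hγσ a)).comp hnsφ)
      (squeeze_zero (fun _ => dist_nonneg) (fun n => ?_) h1)
    rw [Real.dist_eq, Function.comp_apply, dist_comm (z _), dist_comm (z _)]
    exact abs_dist_sub_le _ _ _
  have h3 : Tendsto (fun n => dist (z (k n)) (γ (k n) 0)) atTop (𝓝 (g c)) := by
    rw [← hσ0]
    exact (hg _ _ (hγσ 0)).comp hnsφ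
  have h4 := ((h3.pow 2).sub (h2.pow 2)).const_mul 2
  have h5 : ∀ n, dist (γ (k n) 0) (nearestPoint (range (γ (k n))) (z (k n))) ^ 2 ≤
      2 * (dist (z (k n)) (γ (k n) 0) ^ 2 - dist (z (k n)) (γ (k n) (s (k n))) ^ 2) := fun n => by
    rw [hs]
    exact (hX _).dist_nearestPoint_sq_le (hγ _) _
  have h6 : 2 * (g c ^ 2 - g (σ a) ^ 2) = 0 :=
    le_antisymm (by linarith [hc (σ a)]) (ge_of_tendsto' h4 fun n => (sq_nonneg _).trans (h5 n))
  rw [h6] at h4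
  have h7 := (squeeze_zero (fun n => sq_nonneg _) h5 h4).sqrt
  simpa only [Real.sqrt_sq dist_nonneg, Real.sqrt_zero] using h7

/-- The net equal to `z` at the indices `v n`, and to a net strongly convergent to the asymptotic
center elsewhere, converges weakly to the center. -/
theorem IsAsymptoticDist.weakConv [DecidablePred (· ∈ range v)] (hg : IsAsymptoticDist τ z v g)
    (hτ : IsAsymptoticRelation τ) (hX : ∀ i, IsCAT0 (X i)) (hv : Tendsto v atTop atTop) {c : Y}
    (hc : ∀ p, g c ^ 2 ≤ g p ^ 2) {r : ∀ i, X i} (hr : StrongConv τ r c) :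
    WeakConv τ (fun i => if i ∈ range v then z i else r i) c := by
  intro γ σ hγ _ hσ0 hγσ
  have h0 : StrongConv τ (fun i => γ i 0) c := hσ0 ▸ hγσ 0
  rw [hτ.strongConv_iff h0]
  have h1 := hg.tendsto_dist_nearestPoint hτ hX hv hc hγ hσ0 hγσ
  have h2 := (hτ.strongConv_iff h0).1 hr
  rw [Metric.tendsto_nhds]
  intro ε hε
  obtain ⟨N, hN⟩ := eventually_atTop.1 (Metric.tendsto_nhds.1 h1 ε hε)
  -- Discarding the indices `v 0, …, v (N-1)` ensures that a remaining index in the range of `v` is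
  -- `v n` with `n ≥ N`.
  have h3 : ∀ᶠ i in atTop, ∀ n ∈ Finset.range N, i ≠ v n :=
    (Finset.eventually_all _).2 fun n _ => hτ.eventually_ne c (v n)
  filter_upwards [h3, Metric.tendsto_nhds.1 h2 (ε / 2) (by positivity)] with i hi hri
  rw [Real.dist_0_eq_abs, abs_of_nonneg dist_nonneg] at hri ⊢
  split_ifs with hmem
  · obtain ⟨n, rfl⟩ := hmem
    have hn : N ≤ n := by
      by_contra h
      exact hi n (Finset.mem_range.2 (not_le.1 h)) rfl
    simpa [abs_of_nonneg dist_nonneg] using hN n hn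
  · have := (hγ i).dist_nearestPoint_le (r i)
    linarith

/-- Along `v`, Mosco converging functionals are asymptotically bounded below by the value of the
limit at the asymptotic center. -/
theorem IsAsymptoticDist.eventually_lt (hg : IsAsymptoticDist τ z v g)
    (hτ : IsAsymptoticRelation τ) (hX : ∀ i, IsCAT0 (X i)) (hv : Tendsto v atTop atTop) {c : Y}
    (hc : ∀ p, g c ^ 2 ≤ g p ^ 2) {E : ∀ i, X i → ℝ≥0∞} {F : Y → ℝ≥0∞} (hM : MoscoConv τ E F)
    {e : ℝ≥0∞} (he : e < F c) : ∀ᶠ n in atTop, e < E (v n) (z (v n)) := by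
  classical
  obtain ⟨r, hr⟩ := hτ.exists_strongConv c
  have h := eventually_lt_of_lt_liminf (he.trans_le (hM.le_liminf _ _ (hg.weakConv hτ hX hv hc hr)))
  filter_upwards [hv.eventually h] with n hn
  simpa using hn

/-- Subsequential form of the convergence of Moreau–Yosida approximations and resolvents. -/
theorem VarConv.MoscoConv.exists_subseq_tendsto [∀ i, CompleteSpace (X i)] [CompleteSpace Y]
    [TopologicalSpace.SeparableSpace Y] (hτ : IsAsymptoticRelation τ) (hX : ∀ i, IsCAT0 (X i))
    (hY : IsCAT0 Y) {E : ∀ i, X i → ℝ≥0∞} {F : Y → ℝ≥0∞}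
    (hElsc : ∀ i, LowerSemicontinuous (E i)) (hFlsc : LowerSemicontinuous F)
    (hEconv : ∀ i, GeodesicallyConvex (E i)) (hFconv : GeodesicallyConvex F)
    (hEprop : ∀ i, ∃ x, E i x ≠ ∞) (hFprop : ∃ x, F x ≠ ∞) (hM : MoscoConv τ E F) {lam : ℝ}
    (hlam : 0 < lam) {x y : ∀ i, X i} {x' : Y} (hx : StrongConv τ x x')
    (hy : StrongConv τ y (functionalResolvent F lam x')) {v : ℕ → ι}
    (hv : Tendsto v atTop atTop) :
    ∃ φ : ℕ → ℕ, Tendsto (fun n => moreauYosida (E (v (φ n))) lam (x (v (φ n)))) atTop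
        (𝓝 (moreauYosida F lam x')) ∧
      Tendsto (fun n => dist (y (v (φ n)))
        (functionalResolvent (E (v (φ n))) lam (x (v (φ n))))) atTop (𝓝 0) := by
  have : Nonempty Y := ⟨x'⟩
  set z : ∀ i, X i := fun i => functionalResolvent (E i) lam (x i) with hzdef
  have hz : ∀ i, moreauYosida (E i) lam (x i) =
      ENNReal.ofReal lam * E i (z i) + edist (x i) (z i) ^ 2 := fun i =>
    (hX i).functionalResolvent_spec (hEconv i) (hElsc i) (hEprop i) (x i)
  have hA := hY.functionalResolvent_spec (lam := lam) hFconv hFlsc hFprop x'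
  have hAtop := moreauYosida_ne_top (lam := lam) hFprop x'
  have edist_tendsto : ∀ {a b : ℕ → ℝ} {t : ℝ}, Tendsto a atTop (𝓝 t) →
      Tendsto (fun n => ENNReal.ofReal (a n) ^ 2) atTop (𝓝 (ENNReal.ofReal t ^ 2)) :=
    fun h => ((ENNReal.continuous_pow 2).tendsto _).comp (ENNReal.tendsto_ofReal h)
  -- The recovery net serves as competitor in the infima defining E_i^λ(x_i).
  obtain ⟨q, hq, hEq⟩ := hM.exists_recovery (functionalResolvent F lam x')
  have hupper : Tendsto (fun i => ENNReal.ofReal lam * E i (q i) + edist (x i) (q i) ^ 2) atTop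
      (𝓝 (moreauYosida F lam x')) := by
    rw [hA]
    refine (ENNReal.Tendsto.const_mul hEq (Or.inr ENNReal.ofReal_ne_top)).add ?_
    simp only [edist_dist]
    exact ((ENNReal.continuous_pow 2).tendsto _).comp
      (ENNReal.tendsto_ofReal (hτ.tendsto_dist _ _ _ _ hx hq))
  have hbound : ∀ᶠ i in atTop, dist (z i) (x i) ≤ √(moreauYosida F lam x' + 1).toReal := by
    filter_upwards [hupper.eventually (gt_mem_nhds (ENNReal.lt_add_right hAtop one_ne_zero))]
      with i hi
    have h1 : edist (x i) (z i) ^ 2 ≤ moreauYosida F lam x' + 1 :=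
      le_add_self.trans ((hz i).ge.trans ((moreauYosida_le _ _).trans hi.le))
    apply Real.le_sqrt_of_sq_le
    rw [← ENNReal.ofReal_le_iff_le_toReal (ENNReal.add_ne_top.2 ⟨hAtop, ENNReal.one_ne_top⟩),
      ENNReal.ofReal_pow dist_nonneg, ← edist_dist, edist_comm]
    exact h1
  obtain ⟨φ, hφ, g, hg⟩ := hτ.exists_subseq_tendsto_dist hx hv (hv.eventually hbound)
  have hvφ : Tendsto (fun n => v (φ n)) atTop atTop := hv.comp hφ.tendsto_atTop
  replace hg : IsAsymptoticDist τ z (fun n => v (φ n)) g := hg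
  obtain ⟨c, hc⟩ := hg.exists_center hτ hX hY hvφ
  have hc' : ∀ p, g c ^ 2 ≤ g p ^ 2 := fun p => by linarith [hc p, sq_nonneg (dist c p)]
  have hlam' : ENNReal.ofReal lam ≠ 0 := by simpa using hlam
  -- Only a lower bound on the energies of `z` is known; truncating at the value at `c` turns it
  -- into a genuine limit, usable in a squeeze.
  have hlower : Tendsto (fun n => min (ENNReal.ofReal lam * E (v (φ n)) (z (v (φ n))))
      (ENNReal.ofReal lam * F c) + edist (x (v (φ n))) (z (v (φ n))) ^ 2) atTop
      (𝓝 (ENNReal.ofReal lam * F c + ENNReal.ofReal (g x') ^ 2)) := by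
    refine Tendsto.add (tendsto_order.2 ⟨fun e he => ?_, fun e he => ?_⟩) ?_
    · have h1 : e / ENNReal.ofReal lam < F c := ENNReal.div_lt_of_lt_mul' he
      filter_upwards [hg.eventually_lt hτ hX hvφ hc' hM h1] with n hn
      refine lt_min ?_ he
      rw [ENNReal.div_lt_iff (Or.inl hlam') (Or.inl ENNReal.ofReal_ne_top)] at hn
      rwa [mul_comm]
    · exact Eventually.of_forall fun n => (min_le_right _ _).trans_lt he
    · simp only [edist_comm (x _), edist_dist]
      exact ((ENNReal.continuous_pow 2).tendsto _).comp (ENNReal.tendsto_ofReal (hg _ _ hx))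
  have hle1 : ∀ n, min (ENNReal.ofReal lam * E (v (φ n)) (z (v (φ n))))
      (ENNReal.ofReal lam * F c) + edist (x (v (φ n))) (z (v (φ n))) ^ 2 ≤
      moreauYosida (E (v (φ n))) lam (x (v (φ n))) := fun n => by
    rw [hz]
    gcongr
    exact min_le_left _ _
  have hle2 : ∀ n, moreauYosida (E (v (φ n))) lam (x (v (φ n))) ≤
      ENNReal.ofReal lam * E (v (φ n)) (q (v (φ n))) +
        edist (x (v (φ n))) (q (v (φ n))) ^ 2 := fun n => moreauYosida_le _ _
  have hup := hupper.comp hvφ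
  have hlim : ENNReal.ofReal lam * F c + ENNReal.ofReal (g x') ^ 2 ≤ moreauYosida F lam x' :=
    le_of_tendsto_of_tendsto' hlower hup fun n => (hle1 n).trans (hle2 n)
  have hdg : edist x' c ^ 2 ≤ ENNReal.ofReal (g x') ^ 2 := by
    rw [edist_dist, ← ENNReal.ofReal_pow dist_nonneg, ← ENNReal.ofReal_pow (hg.nonneg hτ x')]
    apply ENNReal.ofReal_le_ofReal
    rw [dist_comm]
    linarith [hc x', sq_nonneg (g c)]
  have hmin := moreauYosida_le (E := F) (lam := lam) x' c
  have hcJ : c = functionalResolvent F lam x' :=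
    hY.eq_functionalResolvent hFconv hFlsc hFprop
      ((add_le_add_right hdg _).trans hlim)
  -- The finite term λF(c) cancels, leaving g(x')² ≤ d(x', c)², while `hc x'` gives the reverse with
  -- g(c)² to spare.
  have hgc : g c = 0 := by
    have h1 : ENNReal.ofReal (g x') ^ 2 ≤ edist x' c ^ 2 :=
      (ENNReal.add_le_add_iff_left (ne_top_of_le_ne_top hAtop
        (le_self_add.trans hlim))).1 (hlim.trans hmin)
    rw [edist_dist, ← ENNReal.ofReal_pow dist_nonneg, ← ENNReal.ofReal_pow (hg.nonneg hτ x'),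
      ENNReal.ofReal_le_ofReal_iff (sq_nonneg _), dist_comm] at h1
    exact pow_eq_zero_iff two_ne_zero |>.1
      (le_antisymm (by linarith [hc x']) (sq_nonneg (g c)))
  refine ⟨φ, ?_, ?_⟩
  · rw [le_antisymm hlim (hmin.trans (add_le_add_right hdg _))] at hlower
    exact tendsto_of_tendsto_of_tendsto_of_le_of_le hlower hup hle1 hle2
  · rw [← hcJ] at hy
    rw [← hgc]
    simpa only [dist_comm (y _)] using hg _ _ hy

end AsymptoticRelation

theorem proposition5p9 {ι : Type u} [Preorder ι] [IsDirectedOrder ι] [Nonempty ι]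
    (hι : ∃ S : Set ι, S.Countable ∧ IsCofinal S)
    {H : ι → Type v} [∀ i, MetricSpace (H i)] [∀ i, CompleteSpace (H i)]
    [∀ i, TopologicalSpace.SeparableSpace (H i)] (hH : ∀ i, IsCAT0 (H i))
    {H' : Type w} [MetricSpace H'] [CompleteSpace H'] [TopologicalSpace.SeparableSpace H']
    (hH' : IsCAT0 H')
    (τ : TopologicalSpace (TotalSpace H H')) (hτ : IsAsymptoticRelation τ)
    (E : ∀ i, H i → ℝ≥0∞) (E' : H' → ℝ≥0∞)
    (hE_lsc : ∀ i, LowerSemicontinuous (E i)) (hE'_lsc : LowerSemicontinuous E')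
    (hE_conv : ∀ i, GeodesicallyConvex (E i)) (hE'_conv : GeodesicallyConvex E')
    (hE_proper : ∀ i, ∃ x, E i x ≠ ∞) (hE'_proper : ∃ x, E' x ≠ ∞)
    (hMosco : MoscoConv τ E E') (lam : ℝ) (hlam : 0 < lam) :
    StrongConvFun τ (fun i => moreauYosida (E i) lam) (moreauYosida E' lam) ∧
      StrongConvMap τ (fun i => functionalResolvent (E i) lam) (functionalResolvent E' lam) := by
  have := isCountablyGenerated_atTop_of_isCofinal hι
  have hsub := fun {x y : ∀ i, H i} {x' : H'} (hx : StrongConv τ x x')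
      (hy : StrongConv τ y (functionalResolvent E' lam x')) {ns : ℕ → ι}
      (hns : Tendsto ns atTop atTop) =>
    hMosco.exists_subseq_tendsto hτ hH hH' hE_lsc hE'_lsc hE_conv hE'_conv hE_proper hE'_proper
      hlam hx hy hns
  refine ⟨fun x x' hx => ?_, fun x x' hx => ?_⟩ <;>
    obtain ⟨y, hy⟩ := hτ.exists_strongConv (functionalResolvent E' lam x')
  · refine tendsto_of_subseq_tendsto fun ns hns => ?_
    obtain ⟨φ, h, -⟩ := hsub hx hy hns
    exact ⟨φ, h⟩
  · rw [hτ.strongConv_iff hy]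
    refine tendsto_of_subseq_tendsto fun ns hns => ?_
    obtain ⟨φ, -, h⟩ := hsub hx hy hns
    exact ⟨φ, h⟩
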